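/- Let $a_0,a_1,a_2,s_0$ be real numbers and let $\tau_1,\tau_2$ be positive real numbers with $\tau_1\neq\tau_2$. Consider the delay-differential equation $$y'(t)+a_0y(t)-a_1y(t-\tau_1)-a_2y(t-\tau_2)=0,$$ whose characteristic quasipolynomial is the entire function $\Delta(s)=s+a_0-a_1e^{-s\tau_1}-a_2e^{-s\tau_2}$, $s\in\mathbb C$. A root of $\Delta$ has multiplicity at least $m$ if $\Delta$ and its derivatives of orders $1,\dots,m-1$ vanish there; it has maximal multiplicity if no root of $\Delta$ has a larger multiplicity. A root $s_0$ of $\Delta$ is strictly dominant if every root $s\neq s_0$ of $\Delta$ satisfies $\operatorname{Re}s<\operatorname{Re}s_0$. The multiplicity-induced-dominancy (MID) property holds for $\Delta$ if some root of maximal multiplicity is strictly dominant. The spectral abscissa is $\sup\{\operatorname{Re}s: s\in\mathbb C,\ \Delta(s)=0\}$. (i) The number $s_0$ is a root of $\Delta$ of multiplicity exactly $3$ and of maximal multiplicity if and only if $$s_0=-a_0-\frac1{\tau_1}-\frac1{\tau_2},\qquad a_1=-\frac{\tau_2}{\tau_1(\tau_2-\tau_1)}e^{s_0\tau_1},\qquad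 a_2=\frac{\tau_1}{\tau_2(\tau_2-\tau_1)}e^{s_0\tau_2}.$$ (ii) In that case, $s_0$ is a strictly dominant root of $\Delta$, the MID property holds for $\Delta$, and the spectral abscissa of the equation equals $s_0$. -/

import Mathlib

/-- The characteristic quasipolynomial `Δ(s) = s + a₀ - a₁ e^{-s τ₁} - a₂ e^{-s τ₂}` of the
delay-differential equation `y'(t) + a₀ y(t) - a₁ y(t - τ₁) - a₂ y(t - τ₂) = 0`. -/
noncomputable def charQuasipoly (a₀ a₁ a₂ τ₁ τ₂ : ℝ) (s : ℂ) : ℂ :=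
  s + (a₀ : ℂ) - (a₁ : ℂ) * Complex.exp (-(s * (τ₁ : ℂ)))
    - (a₂ : ℂ) * Complex.exp (-(s * (τ₂ : ℂ)))

/-- `s` is a root of `f` of multiplicity at least `m` (for `1 ≤ m`):
the derivatives of `f` of orders `0, …, m - 1` vanish at `s`. -/
def MultiplicityAtLeast (f : ℂ → ℂ) (s : ℂ) (m : ℕ) : Prop :=
  ∀ k : ℕ, k < m → iteratedDeriv k f s = 0

/-- `s` has multiplicity exactly `m` as a zero of `f`. -/
def HasMultiplicity (f : ℂ → ℂ) (s : ℂ) (m : ℕ) : Prop :=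
  MultiplicityAtLeast f s m ∧ ¬ MultiplicityAtLeast f s (m + 1)

/-- `s₀` is a root of `f`, and no root of `f` has a multiplicity larger than that of `s₀`. -/
def IsRootOfMaximalMultiplicity (f : ℂ → ℂ) (s₀ : ℂ) : Prop :=
  f s₀ = 0 ∧ ∀ s : ℂ, f s = 0 → ∀ m : ℕ, MultiplicityAtLeast f s m → MultiplicityAtLeast f s₀ m

/-- `s₀` is a strictly dominant root of `f`: every other root has a strictly smaller real part. -/
def IsStrictlyDominantRoot (f : ℂ → ℂ) (s₀ : ℂ) : Prop :=
  f s₀ = 0 ∧ ∀ s : ℂ, f s = 0 → s.re < s₀.re ∨ s = s₀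

/-- The multiplicity-induced-dominancy property: some root of maximal multiplicity is strictly
dominant. -/
def MIDProperty (f : ℂ → ℂ) : Prop :=
  ∃ s₀ : ℂ, IsRootOfMaximalMultiplicity f s₀ ∧ IsStrictlyDominantRoot f s₀

/-- The spectral abscissa, `sup {Re s | f s = 0}`, taken in the extended real line (so that there
are no default values for unbounded or empty sets). -/
noncomputable def spectralAbscissa (f : ℂ → ℂ) : EReal :=
  sSup ((fun s : ℂ => ((s.re : ℝ) : EReal)) '' {s : ℂ | f s = 0})

/-!
The combination `τ₁ τ₂ Δ' + (τ₁ + τ₂) Δ'' + Δ'''` is the nonzero constant `τ₁ τ₂`, so no root has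
multiplicity four, and the equations `Δ = Δ' = Δ'' = 0` at `s₀` are linear in `a₀` and
`aᵢ e^{-s₀ τᵢ}`; solving them gives the stated values (`multiplicityAtLeast_three_iff`).

For strict dominance, put `w = s - s₀` and assume `τ₁ < τ₂`. Then `Δ(s) = w - c + B(w)` with
`c = 1/τ₁ + 1/τ₂` and `B(w) = p e^{-wτ₁} - q e^{-wτ₂}`, where `p, q > 0` and `p q = (τ₂ - τ₁)⁻²`.
The inequality `1 - cos u ≤ u²/2` yields `|B(w)| < |w + c|` for `Re w ≥ 0`, `w ≠ 0`
(`norm_lt_norm_add`). On the imaginary axis `|w + c| = |w - c|`, so there are no roots there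
besides `w = 0`. Inside the half-plane, roots are fixed points of
`G = c (w + c - B) / (w + c + B)`, a self-map of the right half-plane which fixes the boundary
point `0` with derivative `1`. As in Julia's lemma, `Re (1 / G - 1 / w)` is nonnegative on the
boundary, hence positive inside by the Phragmén–Lindelöf and maximum modulus principles, and `G`
has no fixed point there (`sub_add_ne_zero_of_norm_lt`).
-/

/-! ### A boundary fixed point lemma in the right half-plane -/

lemma re_div_pos_of_norm_lt {u b : ℂ} (h : ‖b‖ < ‖u‖) : 0 < ((u + b) / (u - b)).re := by
  have hne : u - b ≠ 0 := fun h0 => by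
    rw [sub_eq_zero.mp h0] at h
    exact lt_irrefl _ h
  have hsq : Complex.normSq b < Complex.normSq u := by
    rw [Complex.normSq_eq_norm_sq, Complex.normSq_eq_norm_sq]
    gcongr
  have key : ((u + b) / (u - b)).re
      = (Complex.normSq u - Complex.normSq b) / Complex.normSq (u - b) := by
    rw [Complex.div_re, ← add_div]
    congr 1
    simp only [Complex.normSq_apply, Complex.add_re, Complex.add_im, Complex.sub_re,
      Complex.sub_im]
    ring
  rw [key]
  exact div_pos (sub_pos.mpr hsq) (Complex.normSq_pos.mpr hne)

/-- A Julia-type lemma in the right half-plane. With `f w = w - c + B w`, the map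
`G = c (w + c - B) / (w + c + B)` sends the half-plane to itself, fixes the zeros of `f`, and has a
boundary fixed point of derivative `1` at `0`; such a map has no fixed point inside. The proof
applies the Phragmén–Lindelöf principle to `exp (-P)`, where `P = 1 / G - 1 / w`. -/
theorem sub_add_ne_zero_of_norm_lt {B : ℂ → ℂ} {c : ℝ} (hc : 0 < c) (hB : Differentiable ℂ B)
    (h0 : B 0 = c) (h1 : deriv B 0 = -1)
    (hlt : ∀ w : ℂ, 0 ≤ w.re → w ≠ 0 → ‖B w‖ < ‖w + c‖)
    {w : ℂ} (hw : 0 ≤ w.re) (hw0 : w ≠ 0) : w - c + B w ≠ 0 := by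
  intro hroot
  have hcC : (c : ℂ) ≠ 0 := by exact_mod_cast hc.ne'
  rcases hw.eq_or_lt with hre | hpos
  · refine (hlt w hw hw0).ne ?_
    rw [show B w = c - w by linear_combination hroot, Complex.norm_def, Complex.norm_def]
    congr 1
    simp only [Complex.normSq_apply, Complex.add_re, Complex.add_im, Complex.sub_re,
      Complex.sub_im, Complex.ofReal_re, Complex.ofReal_im, ← hre]
    ring
  set f : ℂ → ℂ := fun z => z - c + B z with hf
  have hfd : Differentiable ℂ f := by fun_prop
  have hf0 : f 0 = 0 := by simp [hf, h0]
  have hf1 : deriv f 0 = 0 := by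
    have : HasDerivAt f (1 + deriv B 0) 0 :=
      ((hasDerivAt_id (0 : ℂ)).sub_const (c : ℂ)).add (hB 0).hasDerivAt
    rw [this.deriv, h1]
    ring
  -- The double zero of `f` at `0` is divided out, so that `P` below is regular at `0`.
  set k : ℂ → ℂ := dslope (dslope f 0) 0
  have hkd : Differentiable ℂ k := by
    rw [← differentiableOn_univ, Complex.differentiableOn_dslope Filter.univ_mem,
      Complex.differentiableOn_dslope Filter.univ_mem, differentiableOn_univ]
    exact hfd
  have hk : ∀ z, f z = z ^ 2 * k z := by
    intro z
    have e1 := sub_smul_dslope f 0 z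
    have e2 := sub_smul_dslope (dslope f 0) 0 z
    rw [dslope_same, hf1] at e2
    simp only [sub_zero, smul_eq_mul, hf0] at e1 e2
    rw [← e1, ← e2]
    ring
  have hBk : ∀ z, B z = z ^ 2 * k z - z + c := fun z => by
    rw [← hk z]
    simp only [hf]
    ring
  have hden : ∀ z : ℂ, 0 ≤ z.re → 2 - z * k z ≠ 0 := by
    intro z hz h
    by_cases hz0 : z = 0
    · simp [hz0] at h
    · refine (hlt z hz hz0).ne ?_
      rw [hBk z]
      congr 1
      linear_combination (-z) * h
  set P : ℂ → ℂ := fun z => k z * (z + c) / (c * (2 - z * k z)) with hP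
  have hPeq : ∀ z : ℂ, 0 ≤ z.re → z ≠ 0 →
      P z = ((z + c + B z) / (z + c - B z)) / c - 1 / z := by
    intro z hz hz0
    have hd := hden z hz
    have hd' : z + c - B z = z * (2 - z * k z) := by
      rw [hBk z]
      ring
    rw [hd', hBk z]
    simp only [hP]
    rw [div_div, div_sub_div _ _ (mul_ne_zero (mul_ne_zero hz0 hd) hcC) hz0,
      div_eq_div_iff (mul_ne_zero hcC hd) (mul_ne_zero (mul_ne_zero (mul_ne_zero hz0 hd) hcC) hz0)]
    ring
  -- `Re (1 / G) > 0`, so `Re P` exceeds `-Re (1 / z)`: this is `0` on the imaginary axis and is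
  -- bounded below away from `0`, which is all the growth control that is needed.
  have hPre : ∀ z : ℂ, 0 ≤ z.re → z ≠ 0 → -(1 / z).re < (P z).re := by
    intro z hz hz0
    rw [hPeq z hz hz0, Complex.sub_re, Complex.div_ofReal_re]
    have := div_pos (re_div_pos_of_norm_lt (hlt z hz hz0)) hc
    linarith
  have hclos : closure {z : ℂ | 0 < z.re} = {z : ℂ | 0 ≤ z.re} := Complex.closure_setOfPred_lt_re 0
  have hPd : ∀ z : ℂ, 0 ≤ z.re → DifferentiableAt ℂ P z := by
    intro z hz
    have := hkd z
    simp only [hP]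
    exact DifferentiableAt.div (by fun_prop) (by fun_prop) (mul_ne_zero hcC (hden z hz))
  set E : ℂ → ℂ := fun z => Complex.exp (-P z) with hE
  have hEd : ∀ z : ℂ, 0 ≤ z.re → DifferentiableAt ℂ E z := fun z hz => (hPd z hz).neg.cexp
  have hEcl : DiffContOnCl ℂ E {z | 0 < z.re} := by
    refine DifferentiableOn.diffContOnCl ?_
    rw [hclos]
    exact fun z hz => (hEd z hz).differentiableWithinAt
  have hEn : ∀ z, ‖E z‖ = Real.exp (-(P z).re) := fun z => by
    simp only [hE, Complex.norm_exp, Complex.neg_re]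
  have hEbig : ∀ z : ℂ, 0 ≤ z.re → 1 ≤ ‖z‖ → ‖E z‖ ≤ Real.exp 1 := by
    intro z hz hz1
    have hz0 : z ≠ 0 := norm_pos_iff.mp (by linarith)
    rw [hEn]
    have h2 : (1 / z).re ≤ 1 := by
      refine (Complex.re_le_norm _).trans ?_
      rw [norm_div, norm_one]
      exact (div_le_one (by linarith)).mpr hz1
    have := hPre z hz hz0
    exact Real.exp_le_exp.mpr (by linarith)
  have hEim' : ∀ y : ℝ, y ≠ 0 → ‖E (y * Complex.I)‖ < 1 := by
    intro y hy
    rw [hEn, Real.exp_lt_one_iff]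
    have := hPre (y * Complex.I) (by simp) (by simp [hy])
    have h2 : (1 / ((y : ℂ) * Complex.I)).re = 0 := by simp [Complex.inv_re]
    linarith
  have hEim : ∀ y : ℝ, ‖E (y * Complex.I)‖ ≤ 1 := by
    intro y
    rcases ne_or_eq y 0 with hy | rfl
    · exact (hEim' y hy).le
    have hcont : ContinuousAt (fun t : ℝ => ‖E (t * Complex.I)‖) 0 := by
      have h3 : ContinuousAt E (((0 : ℝ) : ℂ) * Complex.I) := (hEd _ (by simp)).continuousAt
      have h4 : ContinuousAt (fun t : ℝ => (t : ℂ) * Complex.I) 0 := by fun_prop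
      exact (ContinuousAt.comp (f := fun t : ℝ => (t : ℂ) * Complex.I) h3 h4).norm
    refine le_of_tendsto (hcont.tendsto.mono_left (nhdsWithin_le_nhds (s := {0}ᶜ))) ?_
    filter_upwards [self_mem_nhdsWithin] with t ht using (hEim' t ht).le
  have hEle : ∀ z : ℂ, 0 ≤ z.re → ‖E z‖ ≤ 1 := by
    intro z hz
    refine PhragmenLindelof.right_half_plane_of_bounded_on_real hEcl ⟨1, one_lt_two, 0, ?_⟩
      ⟨Real.exp 1, ?_⟩ hEim hz
    · refine Asymptotics.IsBigO.of_bound (Real.exp 1) ?_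
      have hlarge : ∀ᶠ z : ℂ in Bornology.cobounded ℂ, 1 ≤ ‖z‖ :=
        tendsto_norm_cobounded_atTop.eventually_ge_atTop 1
      filter_upwards [hlarge.filter_mono inf_le_left,
        Filter.mem_inf_of_right (Filter.mem_principal_self _)] with z hz1 hz2
      simpa using hEbig z (le_of_lt hz2) hz1
    · rw [Filter.eventually_map]
      filter_upwards [Filter.eventually_ge_atTop (1 : ℝ)] with x hx
      refine hEbig x (by simp; linarith) ?_
      rw [Complex.norm_real]
      exact hx.trans (le_abs_self x)
  -- A zero of `f` is a zero of `P`, hence an interior maximum of `‖E‖`; so `E` would be constant,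
  -- but `‖E‖ < 1` at the boundary point `I`.
  have hEw : E w = 1 := by
    have hkw : k w = 0 := by
      have h5 := hk w
      rw [show f w = 0 from hroot] at h5
      simpa [hw0] using h5.symm
    simp [hE, hP, hkw]
  have hmax : IsMaxOn (norm ∘ E) {z | 0 < z.re} w := fun z hz => by
    simpa [hEw] using hEle z (le_of_lt hz)
  have hconst := Complex.eqOn_closure_of_isPreconnected_of_isMaxOn_norm
    (convex_halfSpace_re_gt 0).isPreconnected (isOpen_lt continuous_const Complex.continuous_re)
    hEcl hpos hmax
  have hI : E (((1 : ℝ) : ℂ) * Complex.I) = 1 := by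
    rw [← hEw]
    exact hconst (by rw [hclos]; simp)
  have := hEim' 1 one_ne_zero
  rw [hI, norm_one] at this
  exact lt_irrefl _ this

/-! ### Domination of the exponential part -/

/-- The exponential part of the quasipolynomial normalised at its triple root is dominated by
`w + c` on the closed right half-plane. With `w = x + i y`, its squared modulus is
`(p e^{-xτ₁} - q e^{-xτ₂})² + 2 p q e^{-x(τ₁+τ₂)} (1 - cos (y (τ₂ - τ₁)))`, where
`p q = (τ₂ - τ₁)⁻²`; this is at most `c² + y²`, by `1 - cos u ≤ u² / 2`. -/
lemma norm_lt_norm_add {τ₁ τ₂ c p q : ℝ} (hτ₁ : 0 < τ₁) (hτ : τ₁ < τ₂)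
    (hc : c = 1 / τ₁ + 1 / τ₂) (hp : p = τ₂ / (τ₁ * (τ₂ - τ₁)))
    (hq : q = τ₁ / (τ₂ * (τ₂ - τ₁))) {w : ℂ} (hw : 0 ≤ w.re) (hw0 : w ≠ 0) :
    ‖(p : ℂ) * Complex.exp (-(w * (τ₁ : ℂ))) - (q : ℂ) * Complex.exp (-(w * (τ₂ : ℂ)))‖
      < ‖w + c‖ := by
  obtain ⟨x, y⟩ := w
  simp only at hw
  have hτ₂ : 0 < τ₂ := hτ₁.trans hτ
  have hδ : 0 < τ₂ - τ₁ := sub_pos.mpr hτ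
  have hc0 : 0 < c := by rw [hc]; positivity
  have hp0 : 0 < p := by rw [hp]; positivity
  have hq0 : 0 < q := by rw [hq]; positivity
  have hpq : p - q = c := by
    rw [hp, hq, hc]
    field_simp
    ring
  have hprod : p * q = 1 / (τ₂ - τ₁) ^ 2 := by
    rw [hp, hq]
    field_simp
  set e₁ := Real.exp (-(x * τ₁)) with he₁
  set e₂ := Real.exp (-(x * τ₂)) with he₂
  have e₁pos : 0 < e₁ := Real.exp_pos _
  have e₂pos : 0 < e₂ := Real.exp_pos _
  have e₁le : e₁ ≤ 1 := Real.exp_le_one_iff.mpr (by nlinarith)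
  have e₂le : e₂ ≤ e₁ := Real.exp_le_exp.mpr (by nlinarith)
  -- Convexity of `exp` between `0` and `-x τ₂`.
  have hconv : e₁ ≤ (1 - τ₁ / τ₂) + τ₁ / τ₂ * e₂ := by
    have h := convexOn_exp.2 (Set.mem_univ (0 : ℝ)) (Set.mem_univ (-(x * τ₂)))
      (show 0 ≤ 1 - τ₁ / τ₂ by rw [sub_nonneg, div_le_one hτ₂]; exact hτ.le)
      (show 0 ≤ τ₁ / τ₂ by positivity) (by ring)
    simp only [smul_eq_mul, mul_zero, zero_add, Real.exp_zero, mul_one] at h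
    rwa [show τ₁ / τ₂ * -(x * τ₂) = -(x * τ₁) by field_simp] at h
  have hg0 : 0 ≤ p * e₁ - q * e₂ := by nlinarith
  have hgc : p * e₁ - q * e₂ ≤ c := by
    have h2 : q * (1 - e₂) ≤ q * (τ₂ / τ₁) * (1 - e₁) := by
      have : 1 - e₂ ≤ τ₂ / τ₁ * (1 - e₁) := by
        have h3 : τ₁ / τ₂ * (1 - e₂) ≤ 1 - e₁ := by linarith
        calc 1 - e₂ = τ₂ / τ₁ * (τ₁ / τ₂ * (1 - e₂)) := by field_simp
          _ ≤ _ := by gcongr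
      calc q * (1 - e₂) ≤ q * (τ₂ / τ₁ * (1 - e₁)) := by gcongr
        _ = _ := by ring
    have h4 : q * (τ₂ / τ₁) ≤ p := by
      rw [show q * (τ₂ / τ₁) = 1 / (τ₂ - τ₁) by rw [hq]; field_simp,
        show p = τ₂ / τ₁ * (1 / (τ₂ - τ₁)) by rw [hp]; field_simp]
      exact le_mul_of_one_le_left (by positivity) ((one_le_div hτ₁).mpr hτ.le)
    nlinarith
  have hcos : p * q * (2 * (1 - Real.cos (y * (τ₂ - τ₁)))) ≤ y ^ 2 := by
    have := Real.one_sub_sq_div_two_le_cos (x := y * (τ₂ - τ₁))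
    rw [hprod, div_mul_eq_mul_div, one_mul, div_le_iff₀ (by positivity)]
    nlinarith
  have hcos' : y ≠ 0 → p * q * (2 * (1 - Real.cos (y * (τ₂ - τ₁)))) < y ^ 2 := by
    intro hy
    have := Real.one_sub_sq_div_two_lt_cos (x := y * (τ₂ - τ₁)) (mul_ne_zero hy hδ.ne')
    rw [hprod, div_mul_eq_mul_div, one_mul, div_lt_iff₀ (by positivity)]
    nlinarith
  have hcos0 : 0 ≤ p * q * (2 * (1 - Real.cos (y * (τ₂ - τ₁)))) := by
    have := Real.cos_le_one (y * (τ₂ - τ₁))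
    have : 0 ≤ 1 - Real.cos (y * (τ₂ - τ₁)) := by linarith
    positivity
  have hsq : Complex.normSq ((p : ℂ) * Complex.exp (-(⟨x, y⟩ * (τ₁ : ℂ)))
      - (q : ℂ) * Complex.exp (-(⟨x, y⟩ * (τ₂ : ℂ))))
      = (p * e₁ - q * e₂) ^ 2
        + e₁ * e₂ * (p * q * (2 * (1 - Real.cos (y * (τ₂ - τ₁))))) := by
    rw [show y * (τ₂ - τ₁) = y * τ₂ - y * τ₁ by ring, Real.cos_sub]
    simp only [Complex.normSq_apply, Complex.sub_re, Complex.sub_im, Complex.re_ofReal_mul,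
      Complex.im_ofReal_mul, Complex.exp_re, Complex.exp_im, Complex.neg_re, Complex.neg_im,
      Complex.re_mul_ofReal, Complex.im_mul_ofReal, Real.cos_neg, Real.sin_neg, ← he₁, ← he₂]
    have s1 := Real.sin_sq_add_cos_sq (y * τ₁)
    have s2 := Real.sin_sq_add_cos_sq (y * τ₂)
    linear_combination (p * e₁) ^ 2 * s1 + (q * e₂) ^ 2 * s2
  rw [← sq_lt_sq₀ (norm_nonneg _) (norm_nonneg _), ← Complex.normSq_eq_norm_sq,
    ← Complex.normSq_eq_norm_sq, hsq]
  have hR : Complex.normSq ((⟨x, y⟩ : ℂ) + c) = (x + c) ^ 2 + y ^ 2 := by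
    simp [Complex.normSq_apply]
    ring
  rw [hR]
  have hee : e₁ * e₂ ≤ 1 := by nlinarith
  have hA : (p * e₁ - q * e₂) ^ 2 ≤ c ^ 2 := by gcongr
  have hBd := mul_le_of_le_one_left hcos0 hee
  rcases hw.eq_or_lt with hx | hx
  · have hy : y ≠ 0 := fun hy => hw0 (by rw [hy, ← hx]; rfl)
    have := hcos' hy
    rw [← hx, zero_add]
    linarith
  · nlinarith

/-! ### Derivatives and multiplicities -/

lemma hasDerivAt_exp_neg_mul (τ s : ℂ) :
    HasDerivAt (fun s : ℂ => Complex.exp (-(s * τ))) (Complex.exp (-(s * τ)) * -τ) s := by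
  simpa using ((hasDerivAt_id s).mul_const τ).neg.cexp

lemma deriv_exp_comb (A B τ₁ τ₂ : ℂ) :
    deriv (fun s : ℂ => A * Complex.exp (-(s * τ₁)) + B * Complex.exp (-(s * τ₂)))
      = fun s => (-τ₁ * A) * Complex.exp (-(s * τ₁)) + (-τ₂ * B) * Complex.exp (-(s * τ₂)) := by
  funext s
  refine (((hasDerivAt_exp_neg_mul τ₁ s).const_mul A).add
    ((hasDerivAt_exp_neg_mul τ₂ s).const_mul B)).deriv.trans ?_
  ring

lemma deriv_charQuasipoly (a₀ a₁ a₂ τ₁ τ₂ : ℝ) :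
    deriv (charQuasipoly a₀ a₁ a₂ τ₁ τ₂) = fun s : ℂ => 1 + (τ₁ * a₁ * Complex.exp (-(s * τ₁))
      + τ₂ * a₂ * Complex.exp (-(s * τ₂))) := by
  funext s
  refine ((((hasDerivAt_id s).add_const (a₀ : ℂ)).sub
    ((hasDerivAt_exp_neg_mul τ₁ s).const_mul (a₁ : ℂ))).sub
    ((hasDerivAt_exp_neg_mul τ₂ s).const_mul (a₂ : ℂ))).deriv.trans ?_
  ring

lemma iteratedDeriv_two_charQuasipoly (a₀ a₁ a₂ τ₁ τ₂ : ℝ) :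
    iteratedDeriv 2 (charQuasipoly a₀ a₁ a₂ τ₁ τ₂) = fun s : ℂ =>
      (-τ₁ * (τ₁ * a₁)) * Complex.exp (-(s * τ₁))
        + (-τ₂ * (τ₂ * a₂)) * Complex.exp (-(s * τ₂)) := by
  rw [iteratedDeriv_succ, iteratedDeriv_one, deriv_charQuasipoly, ← deriv_exp_comb]
  funext s
  exact deriv_const_add _

lemma iteratedDeriv_three_charQuasipoly (a₀ a₁ a₂ τ₁ τ₂ : ℝ) :
    iteratedDeriv 3 (charQuasipoly a₀ a₁ a₂ τ₁ τ₂) = fun s : ℂ =>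
      (-τ₁ * (-τ₁ * (τ₁ * a₁))) * Complex.exp (-(s * τ₁))
        + (-τ₂ * (-τ₂ * (τ₂ * a₂))) * Complex.exp (-(s * τ₂)) := by
  rw [iteratedDeriv_succ, iteratedDeriv_two_charQuasipoly, deriv_exp_comb]

/-- Triple roots are the worst case: the combination `τ₁ τ₂ Δ' + (τ₁ + τ₂) Δ'' + Δ'''` is the
nonzero constant `τ₁ τ₂`. -/
lemma not_multiplicityAtLeast_four {a₀ a₁ a₂ τ₁ τ₂ : ℝ} (hτ₁ : 0 < τ₁) (hτ₂ : 0 < τ₂)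
    (s : ℂ) : ¬ MultiplicityAtLeast (charQuasipoly a₀ a₁ a₂ τ₁ τ₂) s 4 := by
  intro h
  have h1 := h 1 (by norm_num)
  have h2 := h 2 (by norm_num)
  have h3 := h 3 (by norm_num)
  rw [iteratedDeriv_one, deriv_charQuasipoly] at h1
  rw [iteratedDeriv_two_charQuasipoly] at h2
  rw [iteratedDeriv_three_charQuasipoly] at h3
  simp only at h1 h2 h3
  have hne : (τ₁ : ℂ) * τ₂ ≠ 0 := by exact_mod_cast (mul_pos hτ₁ hτ₂).ne'
  refine hne ?_
  linear_combination (τ₁ * τ₂ : ℂ) * h1 + (τ₁ + τ₂ : ℂ) * h2 + h3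

lemma multiplicityAtLeast_three_iff {a₀ a₁ a₂ s₀ τ₁ τ₂ : ℝ} (hτ₁ : 0 < τ₁) (hτ₂ : 0 < τ₂)
    (hτ : τ₁ ≠ τ₂) :
    MultiplicityAtLeast (charQuasipoly a₀ a₁ a₂ τ₁ τ₂) s₀ 3 ↔
      (s₀ = -a₀ - 1 / τ₁ - 1 / τ₂ ∧
        a₁ = -(τ₂ / (τ₁ * (τ₂ - τ₁))) * Real.exp (s₀ * τ₁) ∧
        a₂ = τ₁ / (τ₂ * (τ₂ - τ₁)) * Real.exp (s₀ * τ₂)) := by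
  have hδ : τ₂ - τ₁ ≠ 0 := sub_ne_zero.mpr hτ.symm
  obtain ⟨b₁, hb₁⟩ : ∃ b₁, b₁ = a₁ * Real.exp (-(s₀ * τ₁)) := ⟨_, rfl⟩
  obtain ⟨b₂, hb₂⟩ : ∃ b₂, b₂ = a₂ * Real.exp (-(s₀ * τ₂)) := ⟨_, rfl⟩
  have hval : MultiplicityAtLeast (charQuasipoly a₀ a₁ a₂ τ₁ τ₂) s₀ 3 ↔
      s₀ + a₀ - b₁ - b₂ = 0 ∧ 1 + (τ₁ * b₁ + τ₂ * b₂) = 0 ∧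
        τ₁ ^ 2 * b₁ + τ₂ ^ 2 * b₂ = 0 := by
    have h3 : MultiplicityAtLeast (charQuasipoly a₀ a₁ a₂ τ₁ τ₂) s₀ 3 ↔
        iteratedDeriv 0 (charQuasipoly a₀ a₁ a₂ τ₁ τ₂) s₀ = 0 ∧
        iteratedDeriv 1 (charQuasipoly a₀ a₁ a₂ τ₁ τ₂) s₀ = 0 ∧
        iteratedDeriv 2 (charQuasipoly a₀ a₁ a₂ τ₁ τ₂) s₀ = 0 := by
      refine ⟨fun h => ⟨h 0 (by norm_num), h 1 (by norm_num), h 2 (by norm_num)⟩, ?_⟩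
      rintro ⟨h0, h1, h2⟩ k hk
      interval_cases k <;> assumption
    rw [h3, iteratedDeriv_zero, iteratedDeriv_one, deriv_charQuasipoly,
      iteratedDeriv_two_charQuasipoly, hb₁, hb₂, charQuasipoly]
    refine and_congr ?_ (and_congr ?_ ?_)
    · exact_mod_cast Iff.rfl
    · rw [← Complex.ofReal_inj]
      push_cast
      simp only [mul_assoc]
    · rw [← Complex.ofReal_inj, ← neg_eq_zero]
      push_cast
      ring_nf
  have ha₁ : ∀ r, b₁ = r ↔ a₁ = r * Real.exp (s₀ * τ₁) := fun r => by
    rw [hb₁, Real.exp_neg, ← div_eq_mul_inv, div_eq_iff (Real.exp_pos _).ne']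
  have ha₂ : ∀ r, b₂ = r ↔ a₂ = r * Real.exp (s₀ * τ₂) := fun r => by
    rw [hb₂, Real.exp_neg, ← div_eq_mul_inv, div_eq_iff (Real.exp_pos _).ne']
  rw [hval, ← ha₁, ← ha₂]
  constructor
  · rintro ⟨h0, h1, h2⟩
    have e1 : b₁ = -(τ₂ / (τ₁ * (τ₂ - τ₁))) := by
      field_simp
      linear_combination τ₂ * h1 - h2
    have e2 : b₂ = τ₁ / (τ₂ * (τ₂ - τ₁)) := by
      field_simp
      linear_combination h2 - τ₁ * h1
    refine ⟨?_, e1, e2⟩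
    rw [e1, e2] at h0
    field_simp at h0 ⊢
    refine mul_left_cancel₀ hδ ?_
    linear_combination h0
  · rintro ⟨h0, h1, h2⟩
    rw [h1, h2, h0]
    refine ⟨?_, ?_, ?_⟩ <;> field_simp <;> ring

/-! ### Strict dominance and the spectral abscissa -/

lemma IsStrictlyDominantRoot.spectralAbscissa_eq {f : ℂ → ℂ} {s : ℂ}
    (h : IsStrictlyDominantRoot f s) : spectralAbscissa f = ((s.re : ℝ) : EReal) := by
  refine le_antisymm (sSup_le ?_) (le_sSup ⟨s, h.1, rfl⟩)
  rintro _ ⟨z, hz, rfl⟩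
  rcases h.2 z hz with hlt | rfl
  · exact EReal.coe_le_coe_iff.mpr hlt.le
  · exact le_rfl

lemma charQuasipoly_swap (a₀ a₁ a₂ τ₁ τ₂ : ℝ) :
    charQuasipoly a₀ a₁ a₂ τ₁ τ₂ = charQuasipoly a₀ a₂ a₁ τ₂ τ₁ := by
  funext s
  simp only [charQuasipoly]
  ring

lemma isStrictlyDominantRoot_of_lt {a₀ a₁ a₂ s₀ τ₁ τ₂ : ℝ} (hτ₁ : 0 < τ₁) (hτ : τ₁ < τ₂)
    (h : MultiplicityAtLeast (charQuasipoly a₀ a₁ a₂ τ₁ τ₂) s₀ 3) :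
    IsStrictlyDominantRoot (charQuasipoly a₀ a₁ a₂ τ₁ τ₂) s₀ := by
  have hτ₂ : 0 < τ₂ := hτ₁.trans hτ
  have hδ : τ₂ - τ₁ ≠ 0 := (sub_pos.mpr hτ).ne'
  have hroot : charQuasipoly a₀ a₁ a₂ τ₁ τ₂ s₀ = 0 := by simpa using h 0 (by norm_num)
  refine ⟨hroot, fun s hs => ?_⟩
  by_contra! hcon
  obtain ⟨hre, hne⟩ := hcon
  obtain ⟨hs₀, ha₁, ha₂⟩ := (multiplicityAtLeast_three_iff hτ₁ hτ₂ hτ.ne).mp h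
  obtain ⟨c, hc⟩ : ∃ c, c = 1 / τ₁ + 1 / τ₂ := ⟨_, rfl⟩
  obtain ⟨p, hp⟩ : ∃ p, p = τ₂ / (τ₁ * (τ₂ - τ₁)) := ⟨_, rfl⟩
  obtain ⟨q, hq⟩ : ∃ q, q = τ₁ / (τ₂ * (τ₂ - τ₁)) := ⟨_, rfl⟩
  rw [← hp] at ha₁
  rw [← hq] at ha₂
  let B : ℂ → ℂ := fun w => (p : ℂ) * Complex.exp (-(w * (τ₁ : ℂ)))
    - (q : ℂ) * Complex.exp (-(w * (τ₂ : ℂ)))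
  have hB : Differentiable ℂ B := by fun_prop
  have hB0 : B 0 = c := by
    have : p - q = c := by
      rw [hp, hq, hc]
      field_simp
      ring
    simp [B, ← this]
  have hB1 : deriv B 0 = -1 := by
    have hpq : τ₁ * p - τ₂ * q = 1 := by
      rw [hp, hq]
      field_simp
    have hd : deriv B 0 = -((τ₁ * p - τ₂ * q : ℝ) : ℂ) := by
      refine (((hasDerivAt_exp_neg_mul τ₁ 0).const_mul (p : ℂ)).sub
        ((hasDerivAt_exp_neg_mul τ₂ 0).const_mul (q : ℂ))).deriv.trans ?_
      simp only [zero_mul, neg_zero, Complex.exp_zero]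
      push_cast
      ring
    rw [hd, hpq, Complex.ofReal_one]
  have hc0 : 0 < c := by
    rw [hc]
    positivity
  refine sub_add_ne_zero_of_norm_lt hc0 hB hB0 hB1
    (fun w hw hw0 => norm_lt_norm_add hτ₁ hτ hc hp hq hw hw0)
    (w := s - s₀) (by simpa using hre) (sub_ne_zero.mpr hne) ?_
  have hexp : ∀ τ : ℝ, Complex.exp (-((s - s₀) * (τ : ℂ)))
      = (Real.exp (s₀ * τ) : ℂ) * Complex.exp (-(s * (τ : ℂ))) := fun τ => by
    rw [Complex.ofReal_exp, ← Complex.exp_add]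
    congr 1
    push_cast
    ring
  have hs₀' : (s₀ : ℂ) = -a₀ - c := by
    rw [hs₀, hc]
    push_cast
    ring
  simp only [charQuasipoly, ha₁, ha₂] at hs
  push_cast at hs
  simp only [B, hexp]
  push_cast
  linear_combination hs - hs₀'

theorem isStrictlyDominantRoot_charQuasipoly {a₀ a₁ a₂ s₀ τ₁ τ₂ : ℝ} (hτ₁ : 0 < τ₁)
    (hτ₂ : 0 < τ₂) (hτ : τ₁ ≠ τ₂)
    (h : MultiplicityAtLeast (charQuasipoly a₀ a₁ a₂ τ₁ τ₂) s₀ 3) :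
    IsStrictlyDominantRoot (charQuasipoly a₀ a₁ a₂ τ₁ τ₂) s₀ := by
  rcases hτ.lt_or_gt with hlt | hlt
  · exact isStrictlyDominantRoot_of_lt hτ₁ hlt h
  · rw [charQuasipoly_swap] at h ⊢
    exact isStrictlyDominantRoot_of_lt hτ₂ hlt h

theorem theorem1 (a₀ a₁ a₂ s₀ τ₁ τ₂ : ℝ) (hτ₁ : 0 < τ₁) (hτ₂ : 0 < τ₂) (hτ : τ₁ ≠ τ₂) :
    ((IsRootOfMaximalMultiplicity (charQuasipoly a₀ a₁ a₂ τ₁ τ₂) (s₀ : ℂ) ∧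
        HasMultiplicity (charQuasipoly a₀ a₁ a₂ τ₁ τ₂) (s₀ : ℂ) 3) ↔
      (s₀ = -a₀ - 1 / τ₁ - 1 / τ₂ ∧
        a₁ = -(τ₂ / (τ₁ * (τ₂ - τ₁))) * Real.exp (s₀ * τ₁) ∧
        a₂ = τ₁ / (τ₂ * (τ₂ - τ₁)) * Real.exp (s₀ * τ₂))) ∧
    ((IsRootOfMaximalMultiplicity (charQuasipoly a₀ a₁ a₂ τ₁ τ₂) (s₀ : ℂ) ∧
        HasMultiplicity (charQuasipoly a₀ a₁ a₂ τ₁ τ₂) (s₀ : ℂ) 3) →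
      IsStrictlyDominantRoot (charQuasipoly a₀ a₁ a₂ τ₁ τ₂) (s₀ : ℂ) ∧
        MIDProperty (charQuasipoly a₀ a₁ a₂ τ₁ τ₂) ∧
        spectralAbscissa (charQuasipoly a₀ a₁ a₂ τ₁ τ₂) = (s₀ : EReal)) := by
  have hmax : (IsRootOfMaximalMultiplicity (charQuasipoly a₀ a₁ a₂ τ₁ τ₂) (s₀ : ℂ) ∧
      HasMultiplicity (charQuasipoly a₀ a₁ a₂ τ₁ τ₂) (s₀ : ℂ) 3) ↔
      MultiplicityAtLeast (charQuasipoly a₀ a₁ a₂ τ₁ τ₂) (s₀ : ℂ) 3 := by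
    refine ⟨fun h => h.2.1, fun h => ⟨⟨by simpa using h 0 (by norm_num), ?_⟩, h,
      not_multiplicityAtLeast_four hτ₁ hτ₂ _⟩⟩
    intro s _ m hm k hk
    refine h k (lt_of_lt_of_le hk ?_)
    by_contra! hm4
    exact not_multiplicityAtLeast_four hτ₁ hτ₂ s fun j hj => hm j (by omega)
  refine ⟨hmax.trans (multiplicityAtLeast_three_iff hτ₁ hτ₂ hτ), fun h => ?_⟩
  have hdom := isStrictlyDominantRoot_charQuasipoly hτ₁ hτ₂ hτ h.2.1
  exact ⟨hdom, ⟨s₀, h.1, hdom⟩, hdom.spectralAbscissa_eq⟩
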